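/- Let $G$ be a finite group. A finite $G$-simplicial complex is a finite simplicial complex $\mathcal K$ with an action of $G$ on its vertices that sends simplices to simplices; it is called free if $G$ acts freely on its geometric realization, which is also denoted $\mathcal K$. For $k\ge 0$ let $E_kG=G^{*(k+1)}$ be the $(k+1)$-fold join of the discrete space $G$ with its natural $G$-action. The mapping index $\operatorname{ind}X$ of a $G$-space $X$ is the least integer $k\ge 0$ for which there is a continuous $G$-equivariant map $X\to E_kG$ (and $\infty$ if there is none). A $G$-poset is a partially ordered set with an order preserving action of $G$. For $n\ge 0$ let $Q_nG$ be the $G$-poset $G\times\{0,\dots,n\}$ with $g\cdot(h,i)=(gh,i)$ and with $(g,i)\prec(h,j)$ if and only if $i<j$. The cross-index $\operatorname{xind}P$ of a $G$-poset $P$ is the least integer $n\ge 0$ for which there is an order preserving $G$-equivariant map $P\to Q_nG$ (and $\infty$ if there is none). The face poset $\mathcal F(\mathcal K)$ consists of the non-empty simplices of $\mathcal K$, ordered by inclusion, with the induced action of $G$. Products of $G$-spaces carry the diagonal action; products of $G$-posets carry the diagonal action and the componentwise order. For an integer $n\ge 0$ consider the following two statements. $\mathsf{HCX}_n(G)$: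 for all finite free $G$-simplicial complexes $\mathcal K_1,\mathcal K_2$, if $\operatorname{xind}\mathcal F(\mathcal K_1)=\operatorname{xind}\mathcal F(\mathcal K_2)=n$, then $\operatorname{xind}\bigl(\mathcal F(\mathcal K_1)\times\mathcal F(\mathcal K_2)\bigr)=n$. $\mathsf{HCT}_n(G)$: for all finite free $G$-simplicial complexes $\mathcal K_1,\mathcal K_2$, if $\operatorname{ind}\mathcal K_1=\operatorname{ind}\mathcal K_2=n$, then $\operatorname{ind}(\mathcal K_1\times\mathcal K_2)=n$. Theorem. For every finite group $G$ and every integer $n\ge 0$, $\mathsf{HCX}_n(G)$ implies $\mathsf{HCT}_n(G)$. -/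

import Mathlib

universe u v

noncomputable section

namespace EquivariantIndex

/-- A `G`-simplicial complex with vertex set `V`: an abstract simplicial complex on `V`, all points
of `V` being vertices, together with an action of `G` on `V` that sends faces to faces. -/
structure GComplex (G : Type v) [Group G] (V : Type u) [MulAction G V] extends
    AbstractSimplicialComplex V where
  /-- the translate of a face is a face -/
  smul_mem : ∀ (g : G), ∀ s ∈ faces, s.map (MulAction.toPerm g).toEmbedding ∈ faces

namespace GComplex

variable {G : Type v} [Group G] {V : Type u} [MulAction G V]

/-- The face poset of a complex: its (non-empty) simplices, ordered by inclusion. -/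
def FacePoset (K : GComplex G V) : Type u := {s : Finset V // s ∈ K.faces}

instance (K : GComplex G V) : PartialOrder K.FacePoset :=
  inferInstanceAs (PartialOrder {s : Finset V // s ∈ K.faces})

instance (K : GComplex G V) : MulAction G K.FacePoset where
  smul g s := ⟨s.1.map (MulAction.toPerm g).toEmbedding, K.smul_mem g s.1 s.2⟩
  one_smul s := Subtype.ext <| Finset.ext fun v => by
    change v ∈ s.1.map _ ↔ _
    simp
  mul_smul g h s := Subtype.ext <| Finset.ext fun v => by
    change v ∈ s.1.map _ ↔ v ∈ (s.1.map _).map _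
    simp [mul_smul]

instance (K : GComplex G V) : CovariantClass G K.FacePoset (· • ·) (· ≤ ·) where
  elim _ _ _ h := Finset.map_subset_map.2 h

/-- The geometric realization of a finite complex: the barycentric coordinate functions on the
vertex set that vanish outside some face, with the topology of `V → ℝ`. -/
def Realization [Fintype V] (K : GComplex G V) : Type u :=
  {x : V → ℝ // x ∈ stdSimplex ℝ V ∧ ∃ s ∈ K.faces, ∀ v, v ∉ s → x v = 0}

instance [Fintype V] (K : GComplex G V) : TopologicalSpace K.Realization :=
  inferInstanceAs (TopologicalSpace
    {x : V → ℝ // x ∈ stdSimplex ℝ V ∧ ∃ s ∈ K.faces, ∀ v, v ∉ s → x v = 0})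

/-- The action of `G` on the realization: the affine extension of the action on vertices. -/
instance [Fintype V] (K : GComplex G V) : MulAction G K.Realization where
  smul g x := ⟨fun v => x.1 (g⁻¹ • v), ⟨fun v => x.2.1.1 _, by
      rw [← x.2.1.2]
      exact Equiv.sum_comp (MulAction.toPerm g⁻¹) x.1⟩, by
    obtain ⟨s, hs, hx⟩ := x.2.2
    refine ⟨_, K.smul_mem g s hs, fun v hv => hx _ fun hvs => hv ?_⟩
    exact Finset.mem_map.2 ⟨_, hvs, by simp⟩⟩
  one_smul x := Subtype.ext <| funext fun v => by
    change x.1 ((1 : G)⁻¹ • v) = x.1 v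
    simp
  mul_smul g h x := Subtype.ext <| funext fun v => by
    change x.1 ((g * h)⁻¹ • v) = x.1 (h⁻¹ • g⁻¹ • v)
    simp [mul_smul]

instance [Fintype V] (K : GComplex G V) : ContinuousConstSMul G K.Realization where
  continuous_const_smul g :=
    continuous_induced_rng.2 (continuous_pi fun v =>
      (continuous_apply (g⁻¹ • v)).comp continuous_induced_dom)

/-- A `G`-simplicial complex is free if `G` acts freely on its geometric realization. -/
def IsFree [Fintype V] (K : GComplex G V) : Prop := IsCancelSMul G K.Realization

end GComplex

/-- The identifications in the `(k+1)`-fold join of `G` with itself: `(t, x)` stands for the formal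
convex combination `t₀ x₀ + ⋯ + tₖ xₖ`, in which terms with coefficient `0` are disregarded. -/
def joinSetoid (G : Type v) (k : ℕ) :
    Setoid (stdSimplex ℝ (Fin (k + 1)) × (Fin (k + 1) → G)) where
  r p q := p.1 = q.1 ∧ ∀ i, p.1.1 i ≠ 0 → p.2 i = q.2 i
  iseqv :=
    { refl := fun _ => ⟨rfl, fun _ _ => rfl⟩
      symm := fun h => ⟨h.1.symm, fun i hi => (h.2 i (h.1 ▸ hi)).symm⟩
      trans := fun h h' => ⟨h.1.trans h'.1, fun i hi => (h.2 i hi).trans (h'.2 i (h.1 ▸ hi))⟩ }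

/-- The space `E_k G`: the `(k+1)`-fold join of the discrete space `G`. -/
def EG (G : Type v) (k : ℕ) : Type v := Quotient (joinSetoid G k)

/-- The quotient topology, where `G` is discrete. -/
instance (G : Type v) (k : ℕ) : TopologicalSpace (EG G k) :=
  letI : TopologicalSpace G := ⊥
  inferInstanceAs (TopologicalSpace (Quotient (joinSetoid G k)))

/-- The action `g • (t₀ x₀ + ⋯ + tₖ xₖ) = t₀ (g x₀) + ⋯ + tₖ (g xₖ)`. -/
instance (G : Type v) [Group G] (k : ℕ) : MulAction G (EG G k) where
  smul g := Quotient.map (fun p => (p.1, fun i => g * p.2 i))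
    fun _ _ h => ⟨h.1, fun i hi => congrArg (g * ·) (h.2 i hi)⟩
  one_smul x := by
    induction x using Quotient.inductionOn with
    | h p => exact congrArg (Quotient.mk _) (Prod.ext rfl (funext fun i => one_mul _))
  mul_smul g h x := by
    induction x using Quotient.inductionOn with
    | h p => exact congrArg (Quotient.mk _) (Prod.ext rfl (funext fun i => mul_assoc _ _ _))

instance (G : Type v) [Group G] (k : ℕ) : ContinuousConstSMul G (EG G k) where
  continuous_const_smul g := by
    let : TopologicalSpace G := ⊥
    have : DiscreteTopology G := ⟨rfl⟩
    refine continuous_quot_lift _ (continuous_quotient_mk'.comp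
      (continuous_fst.prodMk (continuous_pi fun i => ?_)))
    exact (continuous_of_discreteTopology (f := fun x : G => g * x)).comp
      ((continuous_apply i).comp continuous_snd)

/-- The mapping index of a `G`-space `X`: the least `k` for which there is a continuous
`G`-equivariant map `X → E_k G` (and `⊤` if there is none). -/
def mappingIndex (G : Type v) [Group G] (X : Type*) [TopologicalSpace X] [MulAction G X]
    [ContinuousConstSMul G X] : ℕ∞ :=
  ⨅ (k : ℕ) (_ : ∃ f : X →[G] EG G k, Continuous f), (k : ℕ∞)

/-- The ground set `G × {0, …, n}` of the poset `Q_n G`. -/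
@[ext]
structure QPoset (G : Type v) (n : ℕ) where
  /-- the component in `G` -/
  elt : G
  /-- the component in `{0, …, n}` -/
  level : Fin (n + 1)

/-- The order of `Q_n G`: `(g, i) < (h, j)` if and only if `i < j`. -/
instance (G : Type v) (n : ℕ) : PartialOrder (QPoset G n) where
  le p q := p = q ∨ p.level < q.level
  lt p q := p.level < q.level
  le_refl _ := Or.inl rfl
  le_trans := by
    rintro _ _ _ (rfl | h) (rfl | h')
    · exact Or.inl rfl
    · exact Or.inr h'
    · exact Or.inr h
    · exact Or.inr (h.trans h')
  le_antisymm := by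
    rintro p q (rfl | h) (h' | h')
    · rfl
    · rfl
    · exact h'.symm
    · exact absurd h' h.asymm
  lt_iff_le_not_ge p q := by
    constructor
    · intro h
      refine ⟨Or.inr h, ?_⟩
      rintro (rfl | h')
      · exact lt_irrefl _ h
      · exact h.asymm h'
    · rintro ⟨rfl | h, h'⟩
      · exact absurd (Or.inl rfl) h'
      · exact h

instance (G : Type v) [Group G] (n : ℕ) : MulAction G (QPoset G n) where
  smul g p := ⟨g * p.elt, p.level⟩
  one_smul _ := QPoset.ext (one_mul _) rfl
  mul_smul _ _ _ := QPoset.ext (mul_assoc _ _ _) rfl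

instance (G : Type v) [Group G] (n : ℕ) : CovariantClass G (QPoset G n) (· • ·) (· ≤ ·) where
  elim g _ _ h := h.imp (congrArg (g • ·)) id

instance {G : Type v} [Group G] {P Q : Type*} [PartialOrder P] [PartialOrder Q] [MulAction G P]
    [MulAction G Q] [CovariantClass G P (· • ·) (· ≤ ·)] [CovariantClass G Q (· • ·) (· ≤ ·)] :
    CovariantClass G (P × Q) (· • ·) (· ≤ ·) where
  elim g _ _ h := ⟨smul_mono_right g h.1, smul_mono_right g h.2⟩

/-- The cross-index of a `G`-poset `P`: the least `n` for which there is an order preserving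
`G`-equivariant map `P → Q_n G` (and `⊤` if there is none). -/
def crossIndex (G : Type v) [Group G] (P : Type*) [PartialOrder P] [MulAction G P]
    [CovariantClass G P (· • ·) (· ≤ ·)] : ℕ∞ :=
  ⨅ (n : ℕ) (_ : ∃ f : P →[G] QPoset G n, Monotone f), (n : ℕ∞)

/-- The statement `HCT_n(G)`: if two finite free `G`-simplicial complexes have mapping index `n`,
then so has the product of their realizations, with the diagonal action. -/
def HCT (G : Type v) [Group G] (n : ℕ) : Prop :=
  ∀ (V₁ V₂ : Type u) [Fintype V₁] [Fintype V₂] [MulAction G V₁] [MulAction G V₂]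
    (K₁ : GComplex G V₁) (K₂ : GComplex G V₂), K₁.IsFree → K₂.IsFree →
    mappingIndex G K₁.Realization = n → mappingIndex G K₂.Realization = n →
    mappingIndex G (K₁.Realization × K₂.Realization) = n

/-- The statement `HCX_n(G)`: if the face posets of two finite free `G`-simplicial complexes have
cross-index `n`, then so has the product of these posets, with the diagonal action. -/
def HCX (G : Type v) [Group G] (n : ℕ) : Prop :=
  ∀ (V₁ V₂ : Type u) [Fintype V₁] [Fintype V₂] [MulAction G V₁] [MulAction G V₂]
    (K₁ : GComplex G V₁) (K₂ : GComplex G V₂), K₁.IsFree → K₂.IsFree →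
    crossIndex G K₁.FacePoset = n → crossIndex G K₂.FacePoset = n →
    crossIndex G (K₁.FacePoset × K₂.FacePoset) = n

end EquivariantIndex

end

/-!
Let `X₁` and `X₂` be compact `G`-spaces of mapping index `n`, and let `f : X₁ × X₂ → E_k G` be an
equivariant map. The nerve `K` of a fine invariant cover of `X = Xᵢ` by balls of an invariant
pseudometric receives a map `X → |K|`, and an order preserving map `F(K) → Q_m G` induces a map
`|K| → E_m G` by barycentric subdivision, so that `n = ind X ≤ ind |K| ≤ xind F(K)`.

In the other direction, one of the `m + 1` coefficients of a point of `E_m G` is at least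
`1 / (m + 1)`. If a map to `E_m G`, given on the vertices of `K` only, varies by less than that on
each simplex, then the vertices of `E_m G` at which a coefficient is that large over a given simplex
form a chain in `Q_m G`, and the greatest element of this chain is an order preserving function of
the simplex. The centres of the balls being points of `X`, this applies to a map `X → E_n G`, whence
`xind F(K) = n`, and to `f` on pairs of centres. The latter gives an order preserving map
`F(K₁) × F(K₂) → Q_k G`, and `n ≤ k` by `HCX`.

Since `f` has to vary little on products of two simplices, the pseudometric on `X₁` is the sup
distance between the maps `f (x, ·)`, and likewise on `X₂`.
-/

namespace EquivariantIndex

open Function Topology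

section GroupActions

variable {G : Type v} [Group G]

theorem isCancelSMul_of_mulActionHom {X Y : Type*} [MulAction G X] [MulAction G Y]
    [IsCancelSMul G Y] (f : X →[G] Y) : IsCancelSMul G X :=
  isCancelSMul_iff_eq_one_of_smul_eq.2 fun g x hg =>
    IsCancelSMul.eq_one_of_smul (x := f x) (by rw [← map_smul, hg])

/-- Greatest elements are unique, which makes their choice equivariant. -/
theorem exists_monotone_mulActionHom_of_isChain {P Q : Type*} [Preorder P] [MulAction G P]
    [PartialOrder Q] [MulAction G Q] [CovariantClass G Q (· • ·) (· ≤ ·)] [Finite Q]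
    {S : P → Set Q} (hne : ∀ c, (S c).Nonempty) (hchain : ∀ c, IsChain (· ≤ ·) (S c))
    (hmono : Monotone S) (hsmul : ∀ (g : G) c, ∀ q ∈ S c, g • q ∈ S (g • c)) :
    ∃ F : P →[G] Q, Monotone F := by
  have exists_isGreatest (c : P) : ∃ q, IsGreatest (S c) q := by
    obtain ⟨q, hq⟩ := (Set.toFinite (S c)).exists_maximal (hne c)
    exact ⟨q, hq.prop, fun p hp => ((hchain c).total hp hq.prop).elim id (hq.le_of_ge hp)⟩
  choose F hF using exists_isGreatest
  refine ⟨⟨F, fun g c => (hF (g • c)).unique ⟨hsmul g c _ (hF c).1, fun q hq => ?_⟩⟩,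
    fun c d hcd => (hF c).mono (hF d) (hmono hcd)⟩
  have h := smul_mono_right g ((hF c).2 (by simpa using hsmul g⁻¹ _ q hq))
  rwa [smul_inv_smul] at h

/-- The functions `c y` are thought of as barycentric coordinates in the space `Y`; those of the
image of `x` are the weights `w x`, divided by their sum. -/
theorem exists_continuous_mulActionHom_of_weights {ι X Y : Type*} [Fintype ι] [MulAction G ι]
    [TopologicalSpace X] [MulAction G X] [TopologicalSpace Y] [MulAction G Y]
    {c : Y → ι → ℝ} (hc : IsEmbedding c) (hcg : ∀ (g : G) y i, c (g • y) (g • i) = c y i)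
    {w : X → ι → ℝ} (hw : Continuous w) (hnonneg : ∀ x i, 0 ≤ w x i)
    (hne : ∀ x, ∃ i, w x i ≠ 0) (hwg : ∀ (g : G) x i, w (g • x) (g • i) = w x i)
    (hrange : ∀ x, ∀ t ∈ stdSimplex ℝ ι, support t ⊆ support (w x) → t ∈ Set.range c) :
    ∃ f : X →[G] Y, Continuous f := by
  have sum_pos (x : X) : 0 < ∑ i, w x i :=
    (hne x).elim fun i hi => Finset.sum_pos' (fun j _ => hnonneg x j)
      ⟨i, Finset.mem_univ i, (hnonneg x i).lt_of_ne' hi⟩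
  have sum_smul (g : G) (x : X) : ∑ i, w (g • x) i = ∑ i, w x i := by
    rw [← Equiv.sum_comp (MulAction.toPerm g)]
    exact Finset.sum_congr rfl fun i _ => hwg g x i
  have exists_normalization (x : X) : ∃ y, c y = fun i => w x i / ∑ j, w x j := by
    refine hrange x _ ⟨fun i => div_nonneg (hnonneg x i) (sum_pos x).le, ?_⟩ fun i hi h0 => hi ?_
    · rw [← Finset.sum_div, div_self (sum_pos x).ne']
    · simp only [h0, zero_div]
  choose f hf using exists_normalization
  refine ⟨⟨f, fun g x => hc.injective (funext fun i => ?_)⟩, hc.continuous_iff.2 ?_⟩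
  · obtain ⟨i, rfl⟩ := MulAction.surjective g i
    simp only [id, hcg, hf, hwg, sum_smul]
  · change Continuous fun x => c (f x)
    simp only [hf]
    exact continuous_pi fun i => ((continuous_apply i).comp hw).div
      (continuous_finsetSum _ fun j _ => (continuous_apply j).comp hw) fun x => (sum_pos x).ne'

theorem dist_map_smul_of_le {X Z : Type*} [MulAction G X] [PseudoMetricSpace Z] {φ : X → Z}
    (h : ∀ (g : G) x y, dist (φ x) (φ y) ≤ dist (φ (g • x)) (φ (g • y))) (g : G) (x y : X) :
    dist (φ (g • x)) (φ (g • y)) = dist (φ x) (φ y) :=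
  (h g x y).antisymm' (by simpa only [inv_smul_smul] using h g⁻¹ (g • x) (g • y))

end GroupActions

namespace QPoset

variable {G : Type v} {n : ℕ}

theorem isChain_iff_injOn_level {s : Set (QPoset G n)} :
    IsChain (· ≤ ·) s ↔ s.InjOn level := by
  refine ⟨fun hs p hp q hq hpq => ?_, fun hs p hp q hq hne => ?_⟩
  · rcases hs.total hp hq with (h | h) | (h | h)
    exacts [h, absurd hpq h.ne, h.symm, absurd hpq h.ne']
  · exact (lt_or_gt_of_ne fun h => hne (hs hp hq h)).imp Or.inr Or.inr

instance [Finite G] : Finite (QPoset G n) :=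
  Finite.of_injective (fun q => (q.elt, q.level)) fun _ _ h =>
    QPoset.ext (Prod.ext_iff.1 h).1 (Prod.ext_iff.1 h).2

noncomputable instance [Finite G] : Fintype (QPoset G n) := Fintype.ofFinite _

end QPoset

namespace EG

variable {G : Type v} {k : ℕ}

open Classical in
/-- The barycentric coordinates of a point of `E_k G`, the vertices being the elements of `Q_k G`:
the coefficient of `g` in the `i`-th term of a formal convex combination is the coordinate at
`(g, i)`. Thus `E_k G` is the space of barycentric coordinates supported on chains of `Q_k G`. -/
noncomputable def coord (y : EG G k) : QPoset G k → ℝ :=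
  Quotient.lift (fun p : stdSimplex ℝ (Fin (k + 1)) × (Fin (k + 1) → G) =>
    fun q => if p.2 q.level = q.elt then p.1.1 q.level else 0) (by
      rintro ⟨t, x⟩ ⟨_, x'⟩ ⟨rfl, h⟩
      funext q
      by_cases hq : t.1 q.level = 0
      · simp only [hq, ite_self]
      · have hx : x q.level = x' q.level := h q.level hq
        simp only [hx]) y

open Classical in
theorem coord_mk (t : stdSimplex ℝ (Fin (k + 1))) (x : Fin (k + 1) → G) (q : QPoset G k) :
    coord (Quotient.mk (joinSetoid G k) (t, x)) q =
      if x q.level = q.elt then t.1 q.level else 0 := rfl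

theorem coord_smul [Group G] (g : G) (y : EG G k) (q : QPoset G k) :
    (g • y).coord (g • q) = y.coord q := by
  classical
  induction y using Quotient.inductionOn with
  | h p => exact if_congr (mul_right_inj (b := p.2 q.level) g) rfl rfl

theorem isChain_support_coord (y : EG G k) : IsChain (· ≤ ·) (support y.coord) := by
  classical
  induction y using Quotient.inductionOn with
  | h p =>
    refine QPoset.isChain_iff_injOn_level.2 fun q hq r hr h => QPoset.ext ?_ h
    rw [← (ite_ne_right_iff.1 hq).1, ← (ite_ne_right_iff.1 hr).1, h]

theorem exists_le_coord (y : EG G k) : ∃ q, 1 / ((k : ℝ) + 1) ≤ y.coord q := by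
  induction y using Quotient.inductionOn with
  | h p =>
    obtain ⟨t, x⟩ := p
    have hsum : ∑ _i : Fin (k + 1), 1 / ((k : ℝ) + 1) ≤ ∑ i, t.1 i := by
      rw [t.2.2, Finset.sum_const, Finset.card_univ, Fintype.card_fin, nsmul_eq_mul,
        Nat.cast_add_one, mul_one_div_cancel (by positivity)]
    obtain ⟨i, -, hi⟩ := Finset.exists_le_of_sum_le Finset.univ_nonempty hsum
    exact ⟨⟨x i, i⟩, by rwa [coord_mk, if_pos rfl]⟩

theorem coord_injective : Injective (coord : EG G k → _) := by
  classical
  intro y z h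
  induction y, z using Quotient.inductionOn₂ with
  | h p q =>
    obtain ⟨⟨t, x⟩, t', x'⟩ := p, q
    have ht (i) : t.1 i = if x' i = x i then t'.1 i else 0 := by
      simpa only [coord_mk, if_true] using congrFun h ⟨x i, i⟩
    have ht' (i) : t'.1 i = if x i = x' i then t.1 i else 0 := by
      simpa only [coord_mk, if_true] using (congrFun h ⟨x' i, i⟩).symm
    refine Quotient.sound ⟨Subtype.ext (funext fun i => ?_), fun i hi => ?_⟩
    · by_cases hi : x i = x' i
      · simpa only [hi, if_true] using ht i
      · exact (ht i).trans ((if_neg (Ne.symm hi)).trans ((ht' i).trans (if_neg hi)).symm)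
    · exact (ite_ne_right_iff.1 ((ht i).symm.trans_ne hi)).1.symm

theorem continuous_coord : Continuous (coord : EG G k → _) := by
  classical
  let : TopologicalSpace G := ⊥
  have : DiscreteTopology G := ⟨rfl⟩
  refine continuous_quot_lift _ (continuous_pi fun q => ?_)
  have hindicator : Continuous fun x : G => if x = q.elt then (1 : ℝ) else 0 :=
    continuous_of_discreteTopology
  have hprod : Continuous fun p : stdSimplex ℝ (Fin (k + 1)) × (Fin (k + 1) → G) =>
      (if p.2 q.level = q.elt then (1 : ℝ) else 0) * p.1.1 q.level :=
    (hindicator.comp ((continuous_apply q.level).comp continuous_snd)).mul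
      ((continuous_apply q.level).comp (continuous_subtype_val.comp continuous_fst))
  simpa only [ite_mul, one_mul, zero_mul] using hprod

instance [Finite G] : CompactSpace (EG G k) :=
  letI : TopologicalSpace G := ⊥
  inferInstanceAs (CompactSpace (Quotient (joinSetoid G k)))

theorem isEmbedding_coord [Finite G] : IsEmbedding (coord : EG G k → _) :=
  (continuous_coord.isClosedEmbedding coord_injective).isEmbedding

theorem mem_range_coord [Nonempty G] [Finite G] {w : QPoset G k → ℝ}
    (hw : w ∈ stdSimplex ℝ (QPoset G k)) (hchain : IsChain (· ≤ ·) (support w)) :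
    w ∈ Set.range (coord : EG G k → _) := by
  have exists_elt (i : Fin (k + 1)) : ∃ g, ∀ h, w ⟨h, i⟩ ≠ 0 → g = h := by
    by_cases hi : ∃ g, w ⟨g, i⟩ ≠ 0
    · exact hi.imp fun g hg h hh =>
        congrArg QPoset.elt (QPoset.isChain_iff_injOn_level.1 hchain hg hh rfl)
    · exact ⟨Classical.arbitrary G, fun h hh => absurd ⟨h, hh⟩ hi⟩
  choose x hx using exists_elt
  have hw0 (q : QPoset G k) (hq : x q.level ≠ q.elt) : w q = 0 :=
    not_imp_comm.1 (hx q.level q.elt) hq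
  have hsum : ∑ i, w ⟨x i, i⟩ = 1 := by
    rw [← hw.2]
    exact Fintype.sum_of_injective (fun i => (⟨x i, i⟩ : QPoset G k))
      (fun i j h => congrArg QPoset.level h) _ w
      (fun q hq => hw0 q fun h => hq ⟨q.level, QPoset.ext h rfl⟩) fun _ => rfl
  refine ⟨Quotient.mk _ (⟨fun i => w ⟨x i, i⟩, fun i => hw.1 _, hsum⟩, x), funext fun q => ?_⟩
  rw [coord_mk]
  split_ifs with hq
  · exact congrArg w (QPoset.ext hq rfl)
  · exact (hw0 q hq).symm

variable [Group G]

instance : IsCancelSMul G (EG G k) :=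
  isCancelSMul_iff_eq_one_of_smul_eq.2 fun g y hg => by
    obtain ⟨q, hq⟩ := y.exists_le_coord
    have hq0 : y.coord q ≠ 0 := (lt_of_lt_of_le (by positivity) hq).ne'
    have hgq0 : y.coord (g • q) ≠ 0 := by rwa [← hg, coord_smul]
    have hgq : g • q = q := QPoset.isChain_iff_injOn_level.1 y.isChain_support_coord hgq0 hq0 rfl
    exact mul_eq_right.1 (congrArg QPoset.elt hgq)

theorem dist_coord_smul [Finite G] (g : G) (y z : EG G k) :
    dist (g • y).coord (g • z).coord = dist y.coord z.coord :=
  dist_map_smul_of_le (fun g y z => (dist_pi_le_iff dist_nonneg).2 fun q => by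
    simpa only [coord_smul] using dist_le_pi_dist (g • y).coord (g • z).coord (g • q)) g y z

theorem exists_map_of_weights [Finite G] {X : Type*} [TopologicalSpace X] [MulAction G X]
    {w : X → QPoset G k → ℝ} (hw : Continuous w) (hnonneg : ∀ x q, 0 ≤ w x q)
    (hne : ∀ x, ∃ q, w x q ≠ 0) (hwg : ∀ (g : G) x q, w (g • x) (g • q) = w x q)
    (hchain : ∀ x, IsChain (· ≤ ·) (support (w x))) :
    ∃ f : X →[G] EG G k, Continuous f :=
  exists_continuous_mulActionHom_of_weights isEmbedding_coord coord_smul hw hnonneg hne hwg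
    fun x _ ht hsub => mem_range_coord ht ((hchain x).mono hsub)

/-- Among the `k + 1` terms of a point of `E_k G` one has coefficient at least `1 / (k + 1)`. Sets
on which `f` varies by less than that see at most one such vertex on each level of `Q_k G`. -/
theorem exists_map_QPoset [Finite G] {X P : Type*} [MulAction G X] [Preorder P] [MulAction G P]
    (f : X →[G] EG G k) {C : P → Set X} (hne : ∀ c, (C c).Nonempty) (hmono : Monotone C)
    (hsmul : ∀ (g : G) c, ∀ x ∈ C c, g • x ∈ C (g • c))
    (hsmall : ∀ c, ∀ x ∈ C c, ∀ y ∈ C c, dist (f x).coord (f y).coord < 1 / ((k : ℝ) + 1)) :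
    ∃ F : P →[G] QPoset G k, Monotone F := by
  refine exists_monotone_mulActionHom_of_isChain
    (S := fun c => {q | ∃ x ∈ C c, 1 / ((k : ℝ) + 1) ≤ (f x).coord q}) (fun c => ?_)
    (fun c => QPoset.isChain_iff_injOn_level.2 ?_)
    (fun c d hcd q ⟨x, hx, hq⟩ => ⟨x, hmono hcd hx, hq⟩)
    fun g c q ⟨x, hx, hq⟩ => ⟨g • x, hsmul g c x hx, by rwa [map_smul, coord_smul]⟩
  · obtain ⟨x, hx⟩ := hne c
    exact (f x).exists_le_coord.imp fun q hq => ⟨x, hx, hq⟩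
  · rintro p ⟨x, hx, hp⟩ q ⟨y, hy, hq⟩ hpq
    have hk : 0 < 1 / ((k : ℝ) + 1) := by positivity
    have hp0 : (f y).coord p ≠ 0 := fun h0 => by
      have h := (dist_le_pi_dist (f x).coord (f y).coord p).trans_lt (hsmall c x hx y hy)
      rw [h0, Real.dist_0_eq_abs] at h
      exact (hp.trans (le_abs_self _)).not_gt h
    have hq0 : (f y).coord q ≠ 0 := (hk.trans_le hq).ne'
    exact QPoset.isChain_iff_injOn_level.1 (f y).isChain_support_coord hp0 hq0 hpq

end EG

section Index

variable {G : Type v} [Group G] {X : Type*} [TopologicalSpace X] [MulAction G X]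
  [ContinuousConstSMul G X]

theorem mappingIndex_le {k : ℕ} (f : X →[G] EG G k) (hf : Continuous f) :
    mappingIndex G X ≤ k :=
  iInf₂_le k ⟨f, hf⟩

theorem exists_map_of_mappingIndex_eq {n : ℕ} (h : mappingIndex G X = n) :
    ∃ f : X →[G] EG G n, Continuous f := by
  obtain ⟨k, hk⟩ : ∃ k : ℕ, ⨅ _ : ∃ f : X →[G] EG G k, Continuous f, (k : ℕ∞) = n :=
    (ciInf_mem _).imp fun _ hk => hk.trans h
  by_cases hf : ∃ f : X →[G] EG G k, Continuous f
  · rw [iInf_pos hf] at hk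
    exact Nat.cast_injective hk ▸ hf
  · rw [iInf_neg hf] at hk
    exact absurd hk (ENat.top_ne_natCast n)

theorem mappingIndex_le_of_map {Y : Type*} [TopologicalSpace Y] [MulAction G Y]
    [ContinuousConstSMul G Y] (f : X →[G] Y) (hf : Continuous f) :
    mappingIndex G X ≤ mappingIndex G Y :=
  le_iInf₂ fun _ ⟨e, he⟩ => mappingIndex_le (e.comp f) (he.comp hf)

theorem crossIndex_le {P : Type*} [PartialOrder P] [MulAction G P]
    [CovariantClass G P (· • ·) (· ≤ ·)] {n : ℕ} (F : P →[G] QPoset G n) (hF : Monotone F) :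
    crossIndex G P ≤ n :=
  iInf₂_le n ⟨F, hF⟩

end Index

namespace GComplex

section FlagWeight

variable {V : Type*} [Fintype V]

open Classical in
/-- A function of `x : V → ℝ` that for `x ≥ 0` is positive exactly if the coordinates on `s` are
positive and exceed all others. On a realization it serves as an unnormalized barycentric
coordinate at the vertex `s` of the barycentric subdivision. -/
noncomputable def flagWeight (s : Finset V) (x : V → ℝ) : ℝ :=
  ∏ v ∈ s, x v * ∏ w ∈ sᶜ, max 0 (x v - x w)

theorem continuous_flagWeight (s : Finset V) : Continuous (flagWeight s) := by
  unfold flagWeight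
  fun_prop

theorem flagWeight_nonneg (s : Finset V) {x : V → ℝ} (hx : ∀ v, 0 ≤ x v) : 0 ≤ flagWeight s x :=
  Finset.prod_nonneg fun v _ => mul_nonneg (hx v) (Finset.prod_nonneg fun _ _ => le_max_left _ _)

theorem flagWeight_ne_zero_iff {s : Finset V} {x : V → ℝ} :
    flagWeight s x ≠ 0 ↔ ∀ v ∈ s, x v ≠ 0 ∧ ∀ w ∉ s, x w < x v := by
  simp only [flagWeight, Finset.prod_ne_zero_iff, mul_ne_zero_iff, Finset.mem_compl, ne_eq,
    max_eq_left_iff, sub_nonpos, not_le]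

theorem flagWeight_map (e : V ≃ V) (s : Finset V) (x : V → ℝ) :
    flagWeight (s.map e.toEmbedding) x = flagWeight s (x ∘ e) := by
  classical
  have hcompl : (s.map e.toEmbedding)ᶜ = sᶜ.map e.toEmbedding := by
    ext v
    simp only [Finset.mem_compl, Finset.mem_map_equiv]
  simp only [flagWeight, hcompl, Finset.prod_map, Equiv.coe_toEmbedding, comp_apply]

theorem subset_or_subset_of_flagWeight_ne_zero {s t : Finset V} {x : V → ℝ}
    (hs : flagWeight s x ≠ 0) (ht : flagWeight t x ≠ 0) : s ⊆ t ∨ t ⊆ s := by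
  rw [flagWeight_ne_zero_iff] at hs ht
  by_contra! h
  obtain ⟨v, hvs, hvt⟩ := Finset.not_subset.1 h.1
  obtain ⟨w, hwt, hws⟩ := Finset.not_subset.1 h.2
  exact lt_asymm ((hs v hvs).2 w hws) ((ht w hwt).2 v hvt)

end FlagWeight

section Realization

variable {G : Type v} [Group G] {V : Type u} [Fintype V] [MulAction G V] {K : GComplex G V}

theorem exists_flagWeight_ne_zero (x : K.Realization) :
    ∃ s : K.FacePoset, flagWeight s.1 x.1 ≠ 0 := by
  classical
  obtain ⟨⟨hnonneg, hsum⟩, t, ht, hxt⟩ := x.2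
  obtain ⟨v, -, hv⟩ := Finset.exists_ne_zero_of_sum_ne_zero (hsum.trans_ne one_ne_zero)
  have : Nonempty V := ⟨v⟩
  obtain ⟨m, hm⟩ := Finite.exists_max x.1
  have hm0 : x.1 m ≠ 0 := (((hnonneg v).lt_of_ne' hv).trans_le (hm v)).ne'
  let s : Finset V := {w | x.1 w = x.1 m}
  have mem_s (w : V) : w ∈ s ↔ x.1 w = x.1 m := Finset.mem_filter_univ w
  have hst : s ⊆ t := fun w hw => not_imp_comm.1 (hxt w) (((mem_s w).1 hw).trans_ne hm0)
  refine ⟨⟨s, (K.isRelLowerSet_faces ht).2 hst ⟨m, (mem_s m).2 rfl⟩⟩,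
    flagWeight_ne_zero_iff.2 fun w hw => ?_⟩
  rw [(mem_s w).1 hw]
  exact ⟨hm0, fun w' hw' => (hm w').lt_of_ne (mt (mem_s w').2 hw')⟩

theorem flagWeight_smul (g : G) (s : K.FacePoset) (x : K.Realization) :
    flagWeight (g • s).1 (g • x).1 = flagWeight s.1 x.1 :=
  (flagWeight_map (MulAction.toPerm g) s.1 _).trans <| congrArg _ <| funext fun v =>
    congrArg x.1 (inv_smul_smul g v)

theorem exists_map_EG [Finite G] {m : ℕ} (F : K.FacePoset →[G] QPoset G m) (hF : Monotone F) :
    ∃ f : K.Realization →[G] EG G m, Continuous f := by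
  classical
  have : Finite K.FacePoset := Subtype.finite
  have := Fintype.ofFinite K.FacePoset
  refine EG.exists_map_of_weights (w := fun x q => ∑ s with F s = q, flagWeight s.1 x.1)
    ?_ (fun x q => Finset.sum_nonneg fun s _ => flagWeight_nonneg s.1 x.2.1.1) (fun x => ?_)
    (fun g x q => ?_) fun x => ?_
  · exact continuous_pi fun q => continuous_finsetSum _ fun s _ =>
      (continuous_flagWeight s.1).comp continuous_subtype_val
  · obtain ⟨s, hs⟩ := exists_flagWeight_ne_zero x
    have hpos : 0 < ∑ t with F t = F s, flagWeight t.1 x.1 :=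
      Finset.sum_pos' (fun t _ => flagWeight_nonneg t.1 x.2.1.1)
        ⟨s, (Finset.mem_filter_univ s).2 rfl, (flagWeight_nonneg s.1 x.2.1.1).lt_of_ne' hs⟩
    exact ⟨F s, hpos.ne'⟩
  · refine (Finset.sum_equiv (MulAction.toPerm g) (fun s => ?_) fun s _ => ?_).symm
    · simp only [Finset.mem_filter_univ, MulAction.toPerm_apply, map_smul, smul_left_cancel_iff]
    · exact (flagWeight_smul g s x).symm
  · have hflag : IsChain (· ≤ ·) {s : K.FacePoset | flagWeight s.1 x.1 ≠ 0} :=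
      fun s hs t ht _ => subset_or_subset_of_flagWeight_ne_zero hs ht
    refine (hF.isChain_image hflag).mono fun q hq => ?_
    obtain ⟨s, hs, hs0⟩ := Finset.exists_ne_zero_of_sum_ne_zero hq
    exact ⟨s, hs0, (Finset.mem_filter_univ s).1 hs⟩

theorem mappingIndex_realization_le_crossIndex [Finite G] :
    mappingIndex G K.Realization ≤ crossIndex G K.FacePoset :=
  le_iInf₂ fun _ ⟨F, hF⟩ => (exists_map_EG F hF).elim mappingIndex_le

theorem isFree_of_map_QPoset [Finite G] {m : ℕ} (F : K.FacePoset →[G] QPoset G m)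
    (hF : Monotone F) : K.IsFree :=
  (exists_map_EG F hF).elim fun f _ => isCancelSMul_of_mulActionHom f

theorem exists_map_realization {X : Type*} [TopologicalSpace X] [MulAction G X]
    {w : X → V → ℝ} (hw : Continuous w) (hnonneg : ∀ x v, 0 ≤ w x v)
    (hne : ∀ x, ∃ v, w x v ≠ 0) (hwg : ∀ (g : G) x v, w (g • x) (g • v) = w x v)
    (hface : ∀ x, ∃ s ∈ K.faces, support (w x) ⊆ s) :
    ∃ f : X →[G] K.Realization, Continuous f := by
  refine exists_continuous_mulActionHom_of_weights (c := fun y : K.Realization => y.1)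
    IsEmbedding.subtypeVal (fun g y v => congrArg y.1 (inv_smul_smul g v)) hw hnonneg hne hwg ?_
  intro x t ht hsub
  obtain ⟨s, hs, hxs⟩ := hface x
  exact ⟨⟨t, ht, s, hs, fun v hv => not_not.1 fun h => hv (hxs (hsub h))⟩, rfl⟩

instance : CompactSpace K.Realization := by
  have hclosed : IsClosed (⋃ s ∈ K.faces, ⋂ v ∉ s, {x : V → ℝ | x v = 0}) :=
    (Set.toFinite _).isClosed_biUnion fun s _ => isClosed_biInter fun v _ =>
      isClosed_eq (continuous_apply v) continuous_const
  have hcompact : IsCompact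
      {x : V → ℝ | x ∈ stdSimplex ℝ V ∧ ∃ s ∈ K.faces, ∀ v, v ∉ s → x v = 0} := by
    convert (isCompact_stdSimplex ℝ V).inter_right hclosed using 1
    ext x
    simp only [Set.mem_ofPred_eq, Set.mem_inter_iff, Set.mem_iUnion, Set.mem_iInter, exists_prop]
  exact isCompact_iff_compactSpace.1 hcompact

end Realization

section VertexSet

variable {G : Type v} [Group G] {V : Type u} [MulAction G V] (K : GComplex G V) {X : Type*}
  [MulAction G X] (f : V →[G] X)

/-- The image of the vertices of a simplex under an equivariant map defined on the vertices. -/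
def vertexSet (s : K.FacePoset) : Set X := f '' s.1

theorem vertexSet_nonempty (s : K.FacePoset) : (K.vertexSet f s).Nonempty :=
  (K.isRelLowerSet_faces s.2).1.to_set.image f

theorem vertexSet_mono : Monotone (K.vertexSet f) :=
  fun _ _ hst => Set.image_mono hst

theorem smul_mem_vertexSet (g : G) (s : K.FacePoset) {x : X} (hx : x ∈ K.vertexSet f s) :
    g • x ∈ K.vertexSet f (g • s) := by
  obtain ⟨v, hv, rfl⟩ := hx
  exact ⟨g • v, Finset.mem_map_of_mem _ hv, map_smul f g v⟩

end VertexSet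

/-- The nerve of a cover `U` that is indexed by a set with an action of `G` and invariant. -/
def nerve {G : Type v} [Group G] {X : Type*} [MulAction G X] {V : Type u} [MulAction G V]
    (U : V → Set X) (hne : ∀ v, (U v).Nonempty)
    (hsmul : ∀ (g : G) v, ∀ x ∈ U v, g • x ∈ U (g • v)) : GComplex G V where
  faces := {s | s.Nonempty ∧ ∃ x, ∀ v ∈ s, x ∈ U v}
  isRelLowerSet_faces s hs :=
    ⟨hs.1, fun _ hts ht => ⟨ht, hs.2.imp fun _ hx v hv => hx v (hts hv)⟩⟩
  singleton_mem v := ⟨Finset.singleton_nonempty v, (hne v).imp fun x hx w hw => by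
    rwa [Finset.mem_singleton.1 hw]⟩
  smul_mem := by
    rintro g s ⟨hs, x, hx⟩
    refine ⟨hs.map, g • x, fun p hp => ?_⟩
    obtain ⟨q, hq, rfl⟩ := Finset.mem_map.1 hp
    exact hsmul g q x (hx q hq)

end GComplex

section Approximation

variable {G : Type v} [Group G] [Finite G] {Z : Type*} [PseudoMetricSpace Z]

theorem exists_finite_subMulAction_net {X : Type*} [TopologicalSpace X] [CompactSpace X]
    [MulAction G X] {φ : X → Z} (hφ : Continuous φ) {ε : ℝ} (hε : 0 < ε) :
    ∃ T : SubMulAction G X, Finite T ∧ ∀ x, ∃ p ∈ T, dist (φ p) (φ x) < ε := by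
  obtain ⟨t, ht⟩ := CompactSpace.elim_nhds_subcover (fun p : X => φ ⁻¹' Metric.ball (φ p) ε)
    fun p => hφ.continuousAt.preimage_mem_nhds (Metric.ball_mem_nhds _ hε)
  let T : SubMulAction G X :=
    { carrier := ⋃ g : G, (g • ·) '' (t : Set X)
      smul_mem' := fun g x hx => by
        obtain ⟨h, y, hy, rfl⟩ := Set.mem_iUnion.1 hx
        exact Set.mem_iUnion.2 ⟨g * h, y, hy, mul_smul g h y⟩ }
  refine ⟨T, (Set.finite_iUnion fun g => t.finite_toSet.image _).to_subtype, fun x => ?_⟩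
  obtain ⟨p, hp, hx⟩ := Set.mem_iUnion₂.1 (ht.ge (Set.mem_univ x))
  exact ⟨p, Set.mem_iUnion.2 ⟨1, p, hp, one_smul G p⟩, Metric.mem_ball'.1 hx⟩

/-- The complex is the nerve of a cover by balls for the pseudometric pulled back along `φ`, and `c`
is the map from these balls to their centres. -/
theorem exists_fine_complex {X : Type u} [TopologicalSpace X] [CompactSpace X] [MulAction G X]
    {φ : X → Z} (hφ : Continuous φ)
    (hinv : ∀ (g : G) x y, dist (φ (g • x)) (φ (g • y)) = dist (φ x) (φ y)) {ε : ℝ} (hε : 0 < ε) :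
    ∃ (W : Type u) (_ : Fintype W) (_ : MulAction G W) (K : GComplex G W)
      (r : X →[G] K.Realization) (c : W →[G] X), Continuous r ∧
      ∀ s : K.FacePoset, ∀ x ∈ K.vertexSet c s, ∀ y ∈ K.vertexSet c s, dist (φ x) (φ y) < ε := by
  obtain ⟨T, _, hT⟩ := exists_finite_subMulAction_net (G := G) hφ (half_pos hε)
  have := Fintype.ofFinite T
  let K : GComplex G T := .nerve (fun p => {x | dist (φ p) (φ x) < ε / 2})
    (fun p => ⟨p, (dist_self _).trans_lt (half_pos hε)⟩)
    fun g p x hx => (hinv g p x).trans_lt hx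
  have weight_ne_zero_iff (p x : X) : max 0 (ε / 2 - dist (φ p) (φ x)) ≠ 0 ↔
      dist (φ p) (φ x) < ε / 2 := by
    rw [ne_eq, max_eq_left_iff, sub_nonpos, not_le]
  obtain ⟨r, hr⟩ : ∃ r : X →[G] K.Realization, Continuous r := by
    classical
    refine GComplex.exists_map_realization
      (w := fun x (p : T) => max 0 (ε / 2 - dist (φ p) (φ x))) (by fun_prop)
      (fun x p => le_max_left _ _) (fun x => ?_) (fun g x p => ?_) fun x => ?_
    · obtain ⟨p, hp, hx⟩ := hT x
      exact ⟨⟨p, hp⟩, (weight_ne_zero_iff p x).2 hx⟩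
    · exact congrArg (fun d => max 0 (ε / 2 - d)) (hinv g p x)
    · obtain ⟨p, hp, hx⟩ := hT x
      let s : Finset T := {q | dist (φ q) (φ x) < ε / 2}
      have mem_s (q : T) : q ∈ s ↔ dist (φ q) (φ x) < ε / 2 := Finset.mem_filter_univ q
      exact ⟨s, ⟨⟨⟨p, hp⟩, (mem_s _).2 hx⟩, x, fun q hq => (mem_s q).1 hq⟩,
        fun q hq => (mem_s q).2 ((weight_ne_zero_iff q x).1 hq)⟩
  refine ⟨T, inferInstance, inferInstance, K, r, SubMulAction.subtype T, hr, ?_⟩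
  rintro s _ ⟨p, hp, rfl⟩ _ ⟨q, hq, rfl⟩
  obtain ⟨-, z, hz⟩ := s.2
  calc dist (φ p) (φ q) ≤ dist (φ p) (φ z) + dist (φ q) (φ z) := dist_triangle_right _ _ _
    _ < ε / 2 + ε / 2 := add_lt_add (hz p hp) (hz q hq)
    _ = ε := add_halves ε

/-- The complex has `ind X ≤ ind |K| ≤ xind (F K) ≤ n`. -/
theorem exists_fine_complex_crossIndex_eq {X : Type u} [TopologicalSpace X] [CompactSpace X]
    [MulAction G X] [ContinuousConstSMul G X] {n : ℕ} (hX : mappingIndex G X = n) {φ : X → Z}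
    (hφ : Continuous φ) (hinv : ∀ (g : G) x y, dist (φ (g • x)) (φ (g • y)) = dist (φ x) (φ y))
    {ε : ℝ} (hε : 0 < ε) :
    ∃ (W : Type u) (_ : Fintype W) (_ : MulAction G W) (K : GComplex G W) (c : W →[G] X),
      K.IsFree ∧ crossIndex G K.FacePoset = n ∧
      ∀ s : K.FacePoset, ∀ x ∈ K.vertexSet c s, ∀ y ∈ K.vertexSet c s, dist (φ x) (φ y) < ε := by
  obtain ⟨f, hf⟩ := exists_map_of_mappingIndex_eq hX
  have hδ : 0 < min ε (1 / ((n : ℝ) + 1)) := by positivity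
  obtain ⟨W, _, _, K, r, c, hr, hc⟩ := exists_fine_complex (G := G)
    (φ := fun x => (φ x, (f x).coord)) (hφ.prodMk (EG.continuous_coord.comp hf))
    (fun g x y => by simp only [Prod.dist_eq, hinv, map_smul, EG.dist_coord_smul]) hδ
  simp only [Prod.dist_eq, max_lt_iff, lt_min_iff] at hc
  obtain ⟨F, hF⟩ : ∃ F : K.FacePoset →[G] QPoset G n, Monotone F :=
    EG.exists_map_QPoset f (K.vertexSet_nonempty c) (K.vertexSet_mono c)
      (fun g s _ => K.smul_mem_vertexSet c g s) fun s x hx y hy => (hc s x hx y hy).2.2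
  refine ⟨W, _, _, K, c, GComplex.isFree_of_map_QPoset F hF, (crossIndex_le F hF).antisymm ?_,
    fun s x hx y hy => (hc s x hx y hy).1.1⟩
  calc (n : ℕ∞) = mappingIndex G X := hX.symm
    _ ≤ mappingIndex G K.Realization := mappingIndex_le_of_map r hr
    _ ≤ crossIndex G K.FacePoset := GComplex.mappingIndex_realization_le_crossIndex

end Approximation

section Slices

variable {G : Type v} [Group G] {k : ℕ} {X Y : Type*} [TopologicalSpace X] [MulAction G X]
  [TopologicalSpace Y] [MulAction G Y]

/-- The family of slices `y ↦ f (x, y)` of a map `f : X × Y → E_k G`, in barycentric coordinates.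
The sup distance of two slices is a `G`-invariant pseudometric on `X`. -/
noncomputable def sliceCoord (f : X × Y →[G] EG G k) (hf : Continuous f) :
    C(X, C(Y, QPoset G k → ℝ)) :=
  ContinuousMap.curry ⟨fun p => (f p).coord, EG.continuous_coord.comp hf⟩

variable [Finite G] [CompactSpace Y] (f : X × Y →[G] EG G k) (hf : Continuous f)

theorem dist_coord_le_dist_sliceCoord (x x' : X) (y : Y) :
    dist (f (x, y)).coord (f (x', y)).coord ≤ dist (sliceCoord f hf x) (sliceCoord f hf x') :=
  ContinuousMap.dist_apply_le_dist (f := sliceCoord f hf x) (g := sliceCoord f hf x') y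

theorem dist_sliceCoord_smul (g : G) (x x' : X) :
    dist (sliceCoord f hf (g • x)) (sliceCoord f hf (g • x')) =
      dist (sliceCoord f hf x) (sliceCoord f hf x') := by
  refine dist_map_smul_of_le (φ := sliceCoord f hf)
    (fun g x x' => (ContinuousMap.dist_le dist_nonneg).2 fun y => ?_) g x x'
  calc dist (f (x, y)).coord (f (x', y)).coord
      = dist (f (g • x, g • y)).coord (f (g • x', g • y)).coord := by
        rw [← EG.dist_coord_smul g, ← map_smul, ← map_smul, Prod.smul_mk, Prod.smul_mk]
    _ ≤ dist (sliceCoord f hf (g • x)) (sliceCoord f hf (g • x')) :=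
        dist_coord_le_dist_sliceCoord f hf _ _ _

end Slices

theorem HCX.le_of_map_EG {G : Type v} [Group G] [Finite G] {n k : ℕ}
    (h : HCX.{u, v} G n) {X₁ X₂ : Type u} [TopologicalSpace X₁] [CompactSpace X₁] [MulAction G X₁]
    [ContinuousConstSMul G X₁] [TopologicalSpace X₂] [CompactSpace X₂] [MulAction G X₂]
    [ContinuousConstSMul G X₂] (h₁ : mappingIndex G X₁ = n) (h₂ : mappingIndex G X₂ = n)
    (f : X₁ × X₂ →[G] EG G k) (hf : Continuous f) : n ≤ k := by
  let swap : X₂ × X₁ →[G] X₁ × X₂ := ⟨Prod.swap, fun _ _ => rfl⟩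
  have hswap : Continuous (f.comp swap) := hf.comp continuous_swap
  have hε : 0 < 1 / ((k : ℝ) + 1) / 2 := by positivity
  obtain ⟨W₁, _, _, K₁, c₁, hfree₁, hK₁, hc₁⟩ := exists_fine_complex_crossIndex_eq h₁
    (sliceCoord f hf).continuous (dist_sliceCoord_smul f hf) hε
  obtain ⟨W₂, _, _, K₂, c₂, hfree₂, hK₂, hc₂⟩ := exists_fine_complex_crossIndex_eq h₂
    (sliceCoord _ hswap).continuous (dist_sliceCoord_smul _ hswap) hε
  obtain ⟨F, hF⟩ : ∃ F : K₁.FacePoset × K₂.FacePoset →[G] QPoset G k, Monotone F := by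
    refine EG.exists_map_QPoset f (C := fun s => K₁.vertexSet c₁ s.1 ×ˢ K₂.vertexSet c₂ s.2)
      (fun s => (K₁.vertexSet_nonempty c₁ s.1).prod (K₂.vertexSet_nonempty c₂ s.2))
      (fun s t hst => Set.prod_mono (K₁.vertexSet_mono c₁ hst.1) (K₂.vertexSet_mono c₂ hst.2))
      (fun g s p hp => ⟨K₁.smul_mem_vertexSet c₁ g s.1 hp.1, K₂.smul_mem_vertexSet c₂ g s.2 hp.2⟩)
      ?_
    rintro s ⟨x, y⟩ ⟨hx, hy⟩ ⟨x', y'⟩ ⟨hx', hy'⟩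
    calc dist (f (x, y)).coord (f (x', y')).coord
        ≤ dist (f (x, y)).coord (f (x', y)).coord +
          dist (f (x', y)).coord (f (x', y')).coord := dist_triangle _ _ _
      _ < 1 / ((k : ℝ) + 1) / 2 + 1 / ((k : ℝ) + 1) / 2 := add_lt_add
        ((dist_coord_le_dist_sliceCoord f hf x x' y).trans_lt (hc₁ s.1 x hx x' hx'))
        ((dist_coord_le_dist_sliceCoord _ hswap y y' x').trans_lt (hc₂ s.2 y hy y' hy'))
      _ = 1 / ((k : ℝ) + 1) := add_halves _
  exact Nat.cast_le.1 ((h W₁ W₂ K₁ K₂ hfree₁ hfree₂ hK₁ hK₂).symm.trans_le (crossIndex_le F hF))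

end EquivariantIndex

theorem theorem3_general (G : Type v) [Group G] [Finite G] (n : ℕ)
    (h : EquivariantIndex.HCX.{u, v} G n) (X₁ X₂ : Type u) [TopologicalSpace X₁] [CompactSpace X₁]
    [MulAction G X₁] [ContinuousConstSMul G X₁] [TopologicalSpace X₂] [CompactSpace X₂]
    [MulAction G X₂] [ContinuousConstSMul G X₂] (h₁ : EquivariantIndex.mappingIndex G X₁ = n)
    (h₂ : EquivariantIndex.mappingIndex G X₂ = n) :
    EquivariantIndex.mappingIndex G (X₁ × X₂) = n := by
  refine le_antisymm ?_ (le_iInf₂ fun k ⟨f, hf⟩ => ?_)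
  · exact (EquivariantIndex.mappingIndex_le_of_map (MulActionHom.fst G X₁ X₂)
      continuous_fst).trans h₁.le
  · exact Nat.cast_le.2 (h.le_of_map_EG h₁ h₂ f hf)

theorem theorem3 (G : Type v) [Group G] [Finite G] (n : ℕ)
    (h : EquivariantIndex.HCX.{u, v} G n) : EquivariantIndex.HCT.{u, v} G n :=
  fun _ _ _ _ _ _ K₁ K₂ _ _ h₁ h₂ => theorem3_general G n h K₁.Realization K₂.Realization h₁ h₂
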